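/- Let $\mathfrak N$ be a locally compact, compactly generated topological group, let $G\le\mathfrak N$ be a closed subgroup, let $H$ be a topological group, and let $i_1,i_2\colon H\to G$ be two injective homomorphisms that are homeomorphisms onto open subgroups of finite index in $G$. Suppose that $\varphi$ is an automorphism of the topological group $\mathfrak N$ with $\varphi(i_1(h))=i_2(h)$ for all $h\in H$. Let $$\Gamma=\langle\, G,\ t \mid t\,i_1(h)\,t^{-1}=i_2(h)\ \ \forall h\in H\,\rangle$$ be the HNN extension (the $\mathfrak N$-BS group), with the topology generated by the sets $\gamma U\gamma'$ with $U\subseteq G$ open and $\gamma,\gamma'\in\Gamma$. Let $T$ be the Bass–Serre graph of $\Gamma$: its vertices are the cosets $\gamma G$, $\gamma\in\Gamma$, and its edges join $\gamma G$ to $\gamma tG$, $\gamma\in\Gamma$. Let $\mathrm{Aut}(T)$ carry the topology in which the pointwise stabilizers of finite sets of vertices form a basis of neighbourhoods of the identity, and let $j_T\colon\Gamma\to\mathrm{Aut}(T)$ be the action by left multiplication. Let $\mathbb Z\ltimes_\varphi\mathfrak N$ be the semidirect product in which the generator of the discrete group $\mathbb Z$ acts on $\mathfrak N$ by $\varphi$,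 with the product topology, and let $j_{\mathfrak N}\colon\Gamma\to\mathbb Z\ltimes_\varphi\mathfrak N$ be the homomorphism that is the inclusion on $G$ and sends $t$ to the generator of $\mathbb Z$. Then $T$ is a locally finite tree, and the homomorphism $j=(j_T,j_{\mathfrak N})\colon\Gamma\to\mathrm{Aut}(T)\times(\mathbb Z\ltimes_\varphi\mathfrak N)$ is a topological embedding onto a closed subgroup. -/

import Mathlib

open Topology

/-! ### The topological groups `ℤ ⋉ N` and `Aut T` -/

/-- The product topology on a semidirect product. -/
instance SemidirectProduct.instTopologicalSpace {N K : Type*} [Group N] [Group K]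
    [TopologicalSpace N] [TopologicalSpace K] (f : K →* MulAut N) :
    TopologicalSpace (N ⋊[f] K) :=
  TopologicalSpace.induced (fun x => (x.left, x.right)) inferInstance

/-- The action of (multiplicatively written) `ℤ` on `N` through the powers of an automorphism
of the topological group `N`. -/
def zAction {N : Type*} [Group N] [TopologicalSpace N] (φ : N ≃ₜ* N) :
    Multiplicative ℤ →* MulAut N :=
  zpowersHom (MulAut N) φ.toMulEquiv

theorem continuous_zAction {N : Type*} [Group N] [TopologicalSpace N] (φ : N ≃ₜ* N)
    (k : Multiplicative ℤ) : Continuous (zAction φ k) := by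
  have hmap : ∀ ψ : N ≃ₜ* N, ∀ n : ℕ, Continuous ((ψ.toMulEquiv : MulAut N) ^ n) := by
    intro ψ n
    induction n with
    | zero => exact continuous_id
    | succ n ih => rw [pow_succ]; exact ih.comp ψ.continuous
  have hk : zAction φ k = (φ.toMulEquiv : MulAut N) ^ (Multiplicative.toAdd k) := rfl
  rw [hk]
  obtain ⟨n, hn | hn⟩ := (Multiplicative.toAdd k).eq_nat_or_neg
  · rw [hn, zpow_natCast]; exact hmap φ n
  · rw [hn, zpow_neg, zpow_natCast, ← inv_pow]; exact hmap φ.symm n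

instance zAction_isTopologicalGroup {N : Type*} [Group N] [TopologicalSpace N]
    [IsTopologicalGroup N] (φ : N ≃ₜ* N) :
    IsTopologicalGroup (N ⋊[zAction φ] Multiplicative ℤ) := by
  have hind : IsInducing (fun x : N ⋊[zAction φ] Multiplicative ℤ => (x.left, x.right)) := ⟨rfl⟩
  have hl : Continuous (fun x : N ⋊[zAction φ] Multiplicative ℤ => x.left) :=
    continuous_fst.comp hind.continuous
  have hr : Continuous (fun x : N ⋊[zAction φ] Multiplicative ℤ => x.right) :=
    continuous_snd.comp hind.continuous
  have hact : Continuous (fun p : Multiplicative ℤ × N => zAction φ p.1 p.2) :=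
    continuous_prod_of_discrete_left.2 (continuous_zAction φ)
  exact
    { continuous_mul := hind.continuous_iff.2
        (((hl.comp continuous_fst).mul (hact.comp
          ((hr.comp continuous_fst).prodMk (hl.comp continuous_snd)))).prodMk
          ((hr.comp continuous_fst).mul (hr.comp continuous_snd)))
      continuous_inv := hind.continuous_iff.2
        ((hact.comp (hr.inv.prodMk hl.inv)).prodMk hr.inv) }

/-- The topology on the automorphism group of a graph, given by pointwise convergence on the
(discrete) set of vertices. -/
instance SimpleGraph.autTopologicalSpace {V : Type*} (T : SimpleGraph V) :
    TopologicalSpace (T ≃g T) :=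
  TopologicalSpace.generateFrom {S | ∃ v w : V, S = {g : T ≃g T | g v = w}}

theorem SimpleGraph.isOpen_aut_apply_eq {V : Type*} (T : SimpleGraph V) (v w : V) :
    IsOpen {g : T ≃g T | g v = w} :=
  TopologicalSpace.isOpen_generateFrom_of_mem ⟨v, w, rfl⟩

/-- The pointwise stabilizers of finite sets of vertices form a basis of neighbourhoods of the
identity in the automorphism group of a graph. -/
theorem SimpleGraph.aut_nhds_one_hasBasis {V : Type*} (T : SimpleGraph V) :
    (𝓝 (1 : T ≃g T)).HasBasis (fun K : Set V => K.Finite)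
      (fun K => {g : T ≃g T | ∀ v ∈ K, g v = v}) := by
  rw [Filter.hasBasis_iff]
  intro S
  constructor
  · intro hS
    obtain ⟨U, ⟨F, ⟨hF, hFs⟩, rfl⟩, h1, hUS⟩ :=
      (TopologicalSpace.isTopologicalBasis_of_subbasis (t := T.autTopologicalSpace) rfl
        ).mem_nhds_iff.1 hS
    have key : ∀ A : F, ∃ v : V, {g : T ≃g T | g v = v} ⊆ A := by
      rintro ⟨A, hA⟩
      obtain ⟨v, w, rfl⟩ := hFs hA
      have hv : v = w := Set.mem_sInter.1 h1 _ hA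
      exact ⟨v, fun g hg => hv ▸ hg⟩
    choose f hf using key
    have := hF.to_subtype
    exact ⟨Set.range f, Set.finite_range f, fun g hg => hUS
      (Set.mem_sInter.2 fun A hA => hf ⟨A, hA⟩ (hg _ ⟨⟨A, hA⟩, rfl⟩))⟩
  · rintro ⟨K, hK, hKS⟩
    refine Filter.mem_of_superset ?_ hKS
    have : {g : T ≃g T | ∀ v ∈ K, g v = v} = ⋂ v ∈ K, {g : T ≃g T | g v = v} := by
      ext g; simp
    rw [this]
    exact (Filter.biInter_mem hK).2 fun v _ => (T.isOpen_aut_apply_eq v v).mem_nhds rfl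

instance SimpleGraph.aut_isTopologicalGroup {V : Type*} (T : SimpleGraph V) :
    IsTopologicalGroup (T ≃g T) where
  continuous_mul := by
    refine continuous_generateFrom_iff.2 ?_
    rintro _ ⟨v, w, rfl⟩
    have : (fun p : (T ≃g T) × (T ≃g T) => p.1 * p.2) ⁻¹' {g : T ≃g T | g v = w} =
        ⋃ u : V, {g : T ≃g T | g u = w} ×ˢ {g : T ≃g T | g v = u} := by
      ext ⟨a, b⟩
      simp [RelIso.mul_apply]
    rw [this]
    exact isOpen_iUnion fun u => (T.isOpen_aut_apply_eq u w).prod (T.isOpen_aut_apply_eq v u)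
  continuous_inv := by
    refine continuous_generateFrom_iff.2 ?_
    rintro _ ⟨v, w, rfl⟩
    have : (fun g : T ≃g T => g⁻¹) ⁻¹' {g : T ≃g T | g v = w} = {g : T ≃g T | g w = v} := by
      ext g
      constructor
      · rintro rfl
        exact g.apply_symm_apply v
      · rintro rfl
        exact g.symm_apply_apply w
    rw [this]
    exact T.isOpen_aut_apply_eq w v

/-! ### Baumslag–Solitar data and their HNN extensions -/

/-- The input of the construction of an `N`-BS group: a closed subgroup `G` of the topological
group `N`, two inclusions `i₁`, `i₂` of a topological group `H` onto open subgroups of finite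
index of `G`, and an automorphism `φ` of `N` that conjugates `i₁` to `i₂`. -/
structure BSDatum (N H : Type*) [Group N] [TopologicalSpace N] [Group H] [TopologicalSpace H] where
  G : Subgroup N
  isClosed_G : IsClosed (G : Set N)
  i₁ : H →* G
  i₂ : H →* G
  isOpenEmbedding_i₁ : IsOpenEmbedding i₁
  isOpenEmbedding_i₂ : IsOpenEmbedding i₂
  finiteIndex_i₁ : i₁.range.FiniteIndex
  finiteIndex_i₂ : i₂.range.FiniteIndex
  φ : N ≃ₜ* N
  φ_i₁ : ∀ h : H, φ (i₁ h : N) = (i₂ h : N)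

namespace BSDatum

variable {N H : Type*} [Group N] [TopologicalSpace N] [Group H] [TopologicalSpace H]
  (D : BSDatum N H)

/-- The isomorphism `i₁ h ↦ i₂ h` between the two copies of `H` in `G`. -/
noncomputable def assoc : D.i₁.range ≃* D.i₂.range :=
  (MonoidHom.ofInjective D.isOpenEmbedding_i₁.injective).symm.trans
    (MonoidHom.ofInjective D.isOpenEmbedding_i₂.injective)

theorem assoc_apply (h : H) :
    (D.assoc (MonoidHom.ofInjective D.isOpenEmbedding_i₁.injective h) : D.G) = D.i₂ h := by
  rw [assoc, MulEquiv.trans_apply, MulEquiv.symm_apply_apply]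
  rfl

theorem coe_assoc (a : D.i₁.range) : ((D.assoc a : D.G) : N) = D.φ ((a : D.G) : N) := by
  obtain ⟨h, rfl⟩ := (MonoidHom.ofInjective D.isOpenEmbedding_i₁.injective).surjective a
  rw [assoc_apply, ← D.φ_i₁]
  rfl

/-- The `N`-BS group `Γ = ⟨G, t | t (i₁ h) t⁻¹ = i₂ h for all h in H⟩`. -/
abbrev Gam : Type _ := HNNExtension D.G D.i₁.range D.i₂.range D.assoc

/-- The canonical homomorphism from `G` to `Γ`. -/
noncomputable abbrev of : D.G →* D.Gam := HNNExtension.of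

/-- The stable letter of `Γ`. -/
noncomputable abbrev t : D.Gam := HNNExtension.t

/-- The topology of `Γ` is generated by the sets `γ U γ'` with `U` open in `G`. -/
instance : TopologicalSpace D.Gam :=
  TopologicalSpace.generateFrom
    {S | ∃ (γ γ' : D.Gam) (U : Set D.G), IsOpen U ∧ S = (fun g => γ * D.of g * γ') '' U}

/-- The Bass–Serre tree of the HNN extension: the vertices are the cosets `γ G`, and each `γ` gives
an edge from `γ G` to `γ t G`; this edge depends only on the coset of `γ` modulo `i₂ H`. -/
def tree : SimpleGraph (D.Gam ⧸ D.of.range) :=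
  SimpleGraph.fromRel fun x y => ∃ γ : D.Gam,
    x = (γ : D.Gam ⧸ D.of.range) ∧ y = ((γ * D.t : D.Gam) : D.Gam ⧸ D.of.range)

theorem tree_adj_smul (γ : D.Gam) {x y : D.Gam ⧸ D.of.range} (h : D.tree.Adj x y) :
    D.tree.Adj (γ • x) (γ • y) := by
  rw [tree, SimpleGraph.fromRel_adj] at h ⊢
  refine ⟨fun e => h.1 (smul_left_cancel γ e), ?_⟩
  rcases h.2 with ⟨δ, rfl, rfl⟩ | ⟨δ, rfl, rfl⟩
  · exact Or.inl ⟨γ * δ, rfl, by rw [mul_assoc]; rfl⟩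
  · exact Or.inr ⟨γ * δ, rfl, by rw [mul_assoc]; rfl⟩

/-- The action of `Γ` on the Bass–Serre tree by left multiplication. -/
noncomputable def jT : D.Gam →* (D.tree ≃g D.tree) where
  toFun γ :=
    { toEquiv := (MulAction.toPerm γ : Equiv.Perm (D.Gam ⧸ D.of.range))
      map_rel_iff' := fun {x y} =>
        ⟨fun h => by simpa using D.tree_adj_smul γ⁻¹ h, fun h => D.tree_adj_smul γ h⟩ }
  map_one' := by ext x; exact one_smul D.Gam x
  map_mul' γ δ := by ext x; exact mul_smul γ δ x

/-- The semidirect product `ℤ ⋉ N` given by `φ`. -/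
abbrev Ntilde : Type _ := N ⋊[zAction D.φ] Multiplicative ℤ

/-- The inclusion of `G` into `ℤ ⋉ N`. -/
def inclG : D.G →* D.Ntilde := SemidirectProduct.inl.comp D.G.subtype

/-- The generator of `ℤ` in `ℤ ⋉ N`. -/
def gen : D.Ntilde := SemidirectProduct.inr (Multiplicative.ofAdd 1)

theorem gen_mul_inclG (a : D.i₁.range) :
    D.gen * D.inclG (a : D.G) = D.inclG (D.assoc a : D.G) * D.gen := by
  have h : zAction D.φ (Multiplicative.ofAdd 1) = (D.φ.toMulEquiv : MulAut N) :=
    zpow_one (D.φ.toMulEquiv : MulAut N)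
  apply SemidirectProduct.ext
  · change 1 * zAction D.φ (Multiplicative.ofAdd 1) ((a : D.G) : N) =
      ((D.assoc a : D.G) : N) * zAction D.φ 1 1
    rw [one_mul, (zAction D.φ 1).map_one, mul_one, coe_assoc]
    exact DFunLike.congr_fun h _
  · change Multiplicative.ofAdd 1 * 1 = 1 * Multiplicative.ofAdd (1 : ℤ)
    rw [one_mul, mul_one]

/-- The homomorphism `Γ → ℤ ⋉ N` that is the inclusion on `G` and sends the stable letter to the
generator of `ℤ`. -/
noncomputable def jN : D.Gam →* D.Ntilde :=
  HNNExtension.lift D.inclG D.gen D.gen_mul_inclG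

/-- The homomorphism `j = (j_T, j_N)`. -/
noncomputable def j : D.Gam →* (D.tree ≃g D.tree) × D.Ntilde :=
  D.jT.prod D.jN

end BSDatum

/-! For the tree, connectedness follows from generation by `G` and `t`. Acyclicity comes from an
integer function on the vertices that changes across one chosen edge and no other, which makes every
edge a bridge. It is built from an action of `Γ` on `Γ × ℤ`, so no normal forms enter. Finite index
of the two subgroups gives local finiteness. For the embedding, `G` is the stabilizer of the base
vertex, and on `G` the map `jN` is the inclusion into `N`. Injectivity follows, and so does the fact
that every `γ U γ'` is the preimage of an open set. For closedness, the image of `Γ` is locally a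
single coset `j(γ) j(G)`, so it is enough that `j(G)` is closed. That set is the graph of a map on
the closed set `G`, continuous because `of` is continuous (`continuous_of`). -/

namespace HNNExtension

variable {G : Type*} [Group G] {A B : Subgroup G} {φ : A ≃* B}

/-- For a set `S` of elements of an HNN extension that is a union of left cosets of `B`, there is a
function that is invariant under right multiplication by `G`, and whose increment along right
multiplication by the stable letter is the indicator function of `S`. -/
theorem exists_crossing_count (S : Set (HNNExtension G A B φ))
    (hS : ∀ (x : HNNExtension G A B φ) (b : B), x * of (b : G) ∈ S ↔ x ∈ S) :
    ∃ f : HNNExtension G A B φ → ℤ,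
      (∀ x g, f (x * of g) = f x) ∧ ∀ x, f (x * t) = f x + S.indicator 1 x := by
  classical
  -- Let `Γ` act on `Γ × ℤ` so that `γ` sends `x` to `x γ⁻¹`, with `t` and `t⁻¹` also moving the
  -- counter by the indicator of `S`. Invariance of `S` under `B` is what the HNN relation requires;
  -- `f x` is then the counter of `x⁻¹ • (1, 0)`.
  let ρG : G →* Equiv.Perm (HNNExtension G A B φ × ℤ) :=
    { toFun := fun g =>
        { toFun := fun p => (p.1 * (of g)⁻¹, p.2)
          invFun := fun p => (p.1 * of g, p.2)
          left_inv := fun p => by simp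
          right_inv := fun p => by simp }
      map_one' := by ext p <;> simp
      map_mul' := fun g h => by ext p <;> simp [mul_assoc] }
  let ρt : Equiv.Perm (HNNExtension G A B φ × ℤ) :=
    { toFun := fun p => (p.1 * t⁻¹, p.2 - S.indicator 1 (p.1 * t⁻¹))
      invFun := fun p => (p.1 * t, p.2 + S.indicator 1 p.1)
      left_inv := fun p => by simp
      right_inv := fun p => by simp }
  have hrel : ∀ a : A, ρt * ρG a = ρG (φ a : G) * ρt := by
    intro a
    have h1 : ∀ x : HNNExtension G A B φ,
        x * (of (a : G))⁻¹ * t⁻¹ = x * t⁻¹ * (of (φ a : G))⁻¹ := by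
      intro x
      rw [equiv_eq_conj]; group
    have h2 : ∀ x : HNNExtension G A B φ, x * (of (φ a : G))⁻¹ ∈ S ↔ x ∈ S := by
      intro x
      rw [← hS (x * _) (φ a), inv_mul_cancel_right]
    ext p
    · exact h1 p.1
    · change p.2 - S.indicator 1 (p.1 * (of (a : G))⁻¹ * t⁻¹) = p.2 - S.indicator 1 (p.1 * t⁻¹)
      rw [h1]
      simp only [Set.indicator_apply, h2, Pi.one_apply]
  let ρ := lift ρG ρt hrel
  have hρG : ∀ g, ρ (of g) = ρG g := lift_of ρG ρt hrel
  have hρt : ρ t = ρt := lift_t ρG ρt hrel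
  have hfst : ∀ γ p, (ρ γ p).1 = p.1 * γ⁻¹ := by
    intro γ
    induction γ using HNNExtension.induction_on with
    | of g => intro p; rw [hρG]; rfl
    | t => intro p; rw [hρt]; rfl
    | mul x y hx hy => intro p; rw [map_mul, Equiv.Perm.mul_apply, hx, hy, mul_inv_rev, mul_assoc]
    | inv x hx =>
      intro p
      have := hx (ρ x⁻¹ p)
      rw [← Equiv.Perm.mul_apply, ← map_mul, mul_inv_cancel, map_one] at this
      rw [inv_inv, Equiv.Perm.one_apply] at *
      rw [this, inv_mul_cancel_right]
  have hpair : ∀ x, ρ x⁻¹ (1, 0) = (x, (ρ x⁻¹ (1, 0)).2) := fun x =>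
    Prod.ext (by rw [hfst]; simp) rfl
  refine ⟨fun x => (ρ x⁻¹ (1, 0)).2, fun x g => ?_, fun x => ?_⟩
  · simp only [mul_inv_rev, map_mul, Equiv.Perm.mul_apply]
    rw [← map_inv, hρG]
    rfl
  · simp only [mul_inv_rev, map_mul, Equiv.Perm.mul_apply]
    rw [hpair x, map_inv, hρt]
    rfl

end HNNExtension

/-! ### Bridges, automorphism groups and semidirect products -/

/-- A walk avoiding the edge keeps `f` constant, so it cannot join the two ends. -/
theorem SimpleGraph.isBridge_of_eq_off_edge {V α : Type*} {G : SimpleGraph V} {v w : V}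
    (f : V → α) (hvw : f v ≠ f w)
    (hf : ∀ x y, G.Adj x y → s(x, y) ≠ s(v, w) → f x = f y) : G.IsBridge s(v, w) := by
  rw [SimpleGraph.isBridge_iff]
  rintro ⟨p⟩
  refine hvw ?_
  generalize hG : G.deleteEdges {s(v, w)} = G' at p
  have key : ∀ {x y : V}, G'.Walk x y → f x = f y := by
    intro x y q
    induction q with
    | nil => rfl
    | cons h _ ih =>
      rw [← hG, SimpleGraph.deleteEdges_adj] at h
      exact (hf _ _ h.1 h.2).trans ih
  exact key p

instance SimpleGraph.aut_t2Space {V : Type*} (T : SimpleGraph V) : T2Space (T ≃g T) := by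
  refine ⟨fun g h hgh => ?_⟩
  obtain ⟨v, hv⟩ : ∃ v, g v ≠ h v := by
    by_contra! H
    exact hgh (RelIso.ext H)
  refine ⟨_, _, T.isOpen_aut_apply_eq v (g v), T.isOpen_aut_apply_eq v (h v), rfl, rfl, ?_⟩
  rw [Set.disjoint_left]
  intro k hk hk'
  exact hv (hk.symm.trans hk')

namespace SemidirectProduct

variable {N K : Type*} [Group N] [Group K] [TopologicalSpace N] [TopologicalSpace K]
  (f : K →* MulAut N)

theorem isInducing_left_right :
    IsInducing (fun x : N ⋊[f] K => (x.left, x.right)) := ⟨rfl⟩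

theorem continuous_left : Continuous (fun x : N ⋊[f] K => x.left) :=
  continuous_fst.comp (isInducing_left_right f).continuous

theorem continuous_right : Continuous (fun x : N ⋊[f] K => x.right) :=
  continuous_snd.comp (isInducing_left_right f).continuous

theorem continuous_inl : Continuous (inl : N → N ⋊[f] K) :=
  (isInducing_left_right f).continuous_iff.2 (continuous_id.prodMk continuous_const)

end SemidirectProduct

namespace BSDatum

variable {N H : Type*} [Group N] [TopologicalSpace N] [Group H] [TopologicalSpace H]
  (D : BSDatum N H)

/-! ### The Bass–Serre tree -/

/-- The vertex `γ G` of the Bass–Serre tree. -/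
noncomputable abbrev vertex (γ : D.Gam) : D.Gam ⧸ D.of.range := γ

theorem vertex_eq_iff {γ δ : D.Gam} : D.vertex γ = D.vertex δ ↔ ∃ g, δ = γ * D.of g := by
  rw [QuotientGroup.eq]
  constructor
  · rintro ⟨g, hg⟩
    exact ⟨g, by rw [hg, mul_inv_cancel_left]⟩
  · rintro ⟨g, rfl⟩
    exact ⟨g, by rw [inv_mul_cancel_left]⟩

theorem vertex_mul_of (γ : D.Gam) (g : D.G) : D.vertex (γ * D.of g) = D.vertex γ :=
  (D.vertex_eq_iff.2 ⟨g, rfl⟩).symm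

theorem exists_crossing_count_vertex (γ₀ : D.Gam) :
    ∃ f : D.Gam ⧸ D.of.range → ℤ, f (D.vertex (γ₀ * D.t)) ≠ f (D.vertex γ₀) ∧
      ∀ γ, f (D.vertex (γ * D.t)) ≠ f (D.vertex γ) →
        D.vertex γ = D.vertex γ₀ ∧ D.vertex (γ * D.t) = D.vertex (γ₀ * D.t) := by
  classical
  -- Since `b t = t a` whenever `b` in `i₂ H` corresponds to `a` in `i₁ H`, the coset `γ₀ i₂(H)`
  -- consists of elements defining the same edge as `γ₀`.
  let S : Set D.Gam := {x | ∃ b : D.i₂.range, x = γ₀ * D.of (b : D.G)}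
  have hS : ∀ (x : D.Gam) (b : D.i₂.range), x * D.of (b : D.G) ∈ S ↔ x ∈ S := by
    intro x b
    constructor
    · rintro ⟨c, hc⟩
      refine ⟨c * b⁻¹, ?_⟩
      rw [Subgroup.coe_mul, map_mul, ← mul_assoc, ← hc, Subgroup.coe_inv, map_inv,
        mul_inv_cancel_right]
    · rintro ⟨c, rfl⟩
      exact ⟨c * b, by rw [Subgroup.coe_mul, map_mul, mul_assoc]⟩
  obtain ⟨f, hfG, hft⟩ := HNNExtension.exists_crossing_count S hS
  have hf : ∀ a b : D.Gam, QuotientGroup.leftRel D.of.range a b → f a = f b := by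
    intro a b hab
    obtain ⟨g, rfl⟩ := D.vertex_eq_iff.1 (Quotient.sound hab)
    exact (hfG a g).symm
  refine ⟨fun x => Quotient.liftOn' x f hf, ?_, fun γ hγ => ?_⟩
  · change f (γ₀ * D.t) ≠ f γ₀
    rw [hft, Set.indicator_of_mem (show γ₀ ∈ S from ⟨1, by simp⟩)]
    simp
  · change f (γ * D.t) ≠ f γ at hγ
    rw [hft] at hγ
    have hmem : γ ∈ S := by
      by_contra h
      exact hγ (by rw [Set.indicator_of_notMem h, add_zero])
    obtain ⟨b, rfl⟩ := hmem
    refine ⟨D.vertex_mul_of γ₀ b, ?_⟩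
    rw [mul_assoc, HNNExtension.of_mul_t, ← mul_assoc, vertex_mul_of]

theorem tree_adj_iff {x y : D.Gam ⧸ D.of.range} :
    D.tree.Adj x y ↔ ∃ γ, (x = D.vertex γ ∧ y = D.vertex (γ * D.t)) ∨
      (y = D.vertex γ ∧ x = D.vertex (γ * D.t)) := by
  rw [tree, SimpleGraph.fromRel_adj, exists_or]
  refine and_iff_right_of_imp fun h e => ?_
  subst e
  -- There are no loops: the crossing count takes different values at the two ends of an edge.
  have key : ∃ γ, x = D.vertex γ ∧ x = D.vertex (γ * D.t) := h.elim id id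
  obtain ⟨γ, h1, h2⟩ := key
  obtain ⟨f, hf, -⟩ := D.exists_crossing_count_vertex γ
  exact hf (by rw [← h1, ← h2])

theorem tree_isAcyclic : D.tree.IsAcyclic := by
  rw [SimpleGraph.isAcyclic_iff_forall_adj_isBridge]
  have key : ∀ γ, D.tree.IsBridge s(D.vertex γ, D.vertex (γ * D.t)) := by
    intro γ
    obtain ⟨f, hf, hf'⟩ := D.exists_crossing_count_vertex γ
    refine SimpleGraph.isBridge_of_eq_off_edge f hf.symm fun x y hxy hne => ?_
    by_contra hfxy
    obtain ⟨δ, ⟨rfl, rfl⟩ | ⟨rfl, rfl⟩⟩ := D.tree_adj_iff.1 hxy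
    · obtain ⟨h1, h2⟩ := hf' δ (Ne.symm hfxy)
      exact hne (by rw [h1, h2])
    · obtain ⟨h1, h2⟩ := hf' δ hfxy
      exact hne (by rw [h1, h2, Sym2.eq_swap])
  intro v w hvw
  obtain ⟨γ, ⟨rfl, rfl⟩ | ⟨rfl, rfl⟩⟩ := D.tree_adj_iff.1 hvw
  · exact key γ
  · rw [Sym2.eq_swap]; exact key γ

theorem tree_reachable_smul (γ : D.Gam) {x y : D.Gam ⧸ D.of.range} (h : D.tree.Reachable x y) :
    D.tree.Reachable (γ • x) (γ • y) :=
  h.map (D.jT γ).toHom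

theorem tree_reachable_vertex (γ : D.Gam) : D.tree.Reachable (D.vertex 1) (D.vertex γ) := by
  induction γ using HNNExtension.induction_on with
  | of g => rw [← one_mul (HNNExtension.of g), vertex_mul_of]
  | t => exact (D.tree_adj_iff.2 ⟨1, Or.inl ⟨rfl, by rw [one_mul]⟩⟩).reachable
  | mul x y hx hy =>
    have := D.tree_reachable_smul x hy
    rw [MulAction.Quotient.smul_coe, MulAction.Quotient.smul_coe, smul_eq_mul, mul_one] at this
    exact hx.trans this
  | inv x hx =>
    have := D.tree_reachable_smul x⁻¹ hx
    rw [MulAction.Quotient.smul_coe, MulAction.Quotient.smul_coe, smul_eq_mul, smul_eq_mul,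
      mul_one, inv_mul_cancel] at this
    exact this.symm

theorem tree_isTree : D.tree.IsTree where
  connected :=
    { preconnected := fun x y => by
        obtain ⟨γ, rfl⟩ := QuotientGroup.mk_surjective x
        obtain ⟨δ, rfl⟩ := QuotientGroup.mk_surjective y
        exact (D.tree_reachable_vertex γ).symm.trans (D.tree_reachable_vertex δ)
      nonempty := ⟨D.vertex 1⟩ }
  isAcyclic := D.tree_isAcyclic

/-- Elements of `K` pass through `δ` and are absorbed by `G`, so the vertex depends only on the
coset `g K`. -/
theorem finite_range_vertex (γ δ : D.Gam) (K : Subgroup D.G) [K.FiniteIndex]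
    (h : ∀ k ∈ K, ∃ g, D.of k * δ = δ * D.of g) :
    (Set.range fun g : D.G => D.vertex (γ * D.of g * δ)).Finite := by
  have := Subgroup.finite_quotient_of_finiteIndex (H := K)
  refine (Set.finite_range fun q : D.G ⧸ K => D.vertex (γ * D.of q.out * δ)).subset ?_
  rintro _ ⟨g, rfl⟩
  refine ⟨(g : D.G ⧸ K), ?_⟩
  obtain ⟨k, hk⟩ := QuotientGroup.mk_out_eq_mul K g
  obtain ⟨c, hc⟩ := h k k.2
  change D.vertex (γ * D.of (Quotient.out (g : D.G ⧸ K)) * δ) = D.vertex (γ * D.of g * δ)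
  rw [hk, map_mul, mul_assoc, mul_assoc, hc, ← mul_assoc, ← mul_assoc, vertex_mul_of]

theorem finite_tree_neighborSet (v : D.Gam ⧸ D.of.range) : (D.tree.neighborSet v).Finite := by
  obtain ⟨γ, rfl⟩ := QuotientGroup.mk_surjective v
  have := D.finiteIndex_i₁
  have := D.finiteIndex_i₂
  refine ((D.finite_range_vertex γ D.t D.i₂.range fun b hb => ?_).union
    (D.finite_range_vertex γ D.t⁻¹ D.i₁.range fun a ha => ?_)).subset ?_
  · exact ⟨_, HNNExtension.of_mul_t (⟨b, hb⟩ : D.i₂.range)⟩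
  · exact ⟨_, HNNExtension.of_mul_inv_t (⟨a, ha⟩ : D.i₁.range)⟩
  · intro w hw
    obtain ⟨δ, ⟨h, rfl⟩ | ⟨rfl, h⟩⟩ := D.tree_adj_iff.1 hw
    · obtain ⟨g, rfl⟩ := D.vertex_eq_iff.1 h
      exact Or.inl ⟨g, rfl⟩
    · obtain ⟨g, hg⟩ := D.vertex_eq_iff.1 h
      refine Or.inr ⟨g, ?_⟩
      change D.vertex (γ * D.of g * D.t⁻¹) = _
      rw [← hg, mul_inv_cancel_right]

/-! ### The topology of `Γ` -/

theorem isOpen_image_of {U : Set D.G} (hU : IsOpen U) (γ γ' : D.Gam) :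
    IsOpen ((fun g => γ * D.of g * γ') '' U) :=
  TopologicalSpace.isOpen_generateFrom_of_mem ⟨γ, γ', U, hU, rfl⟩

/-- The map `i₂ ∘ i₁⁻¹` is a homeomorphism between open subgroups of `G`. -/
theorem isOpen_image_assoc {U : Set D.G} (hU : IsOpen U) :
    IsOpen {b : D.G | ∃ a : D.i₁.range, (a : D.G) ∈ U ∧ (D.assoc a : D.G) = b} := by
  have : {b : D.G | ∃ a : D.i₁.range, (a : D.G) ∈ U ∧ (D.assoc a : D.G) = b} =
      D.i₂ '' (D.i₁ ⁻¹' U) := by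
    ext b
    constructor
    · rintro ⟨a, ha, rfl⟩
      obtain ⟨h, rfl⟩ := (MonoidHom.ofInjective D.isOpenEmbedding_i₁.injective).surjective a
      exact ⟨h, ha, (D.assoc_apply h).symm⟩
    · rintro ⟨h, hh, rfl⟩
      exact ⟨MonoidHom.ofInjective D.isOpenEmbedding_i₁.injective h, hh, D.assoc_apply h⟩
  rw [this]
  exact D.isOpenEmbedding_i₂.isOpenMap _ (hU.preimage D.isOpenEmbedding_i₁.continuous)

theorem isOpen_image_assoc_symm {U : Set D.G} (hU : IsOpen U) :
    IsOpen {a : D.G | ∃ b : D.i₂.range, (b : D.G) ∈ U ∧ (D.assoc.symm b : D.G) = a} := by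
  have : {a : D.G | ∃ b : D.i₂.range, (b : D.G) ∈ U ∧ (D.assoc.symm b : D.G) = a} =
      D.i₁ '' (D.i₂ ⁻¹' U) := by
    ext b
    constructor
    · rintro ⟨a, ha, rfl⟩
      obtain ⟨a, rfl⟩ := D.assoc.surjective a
      obtain ⟨h, rfl⟩ := (MonoidHom.ofInjective D.isOpenEmbedding_i₁.injective).surjective a
      rw [assoc_apply] at ha
      exact ⟨h, ha, by rw [MulEquiv.symm_apply_apply]; rfl⟩
    · rintro ⟨h, hh, rfl⟩
      refine ⟨D.assoc (MonoidHom.ofInjective D.isOpenEmbedding_i₁.injective h), ?_, ?_⟩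
      · rwa [assoc_apply]
      · rw [MulEquiv.symm_apply_apply]; rfl
  rw [this]
  exact D.isOpenEmbedding_i₁.isOpenMap _ (hU.preimage D.isOpenEmbedding_i₂.continuous)

/-- The sets whose traces on the left cosets of `G` are open. -/
def IsLeftOpen (S : Set D.Gam) : Prop :=
  ∀ γ : D.Gam, IsOpen {g : D.G | γ * D.of g ∈ S}

section

variable [IsTopologicalGroup N]

theorem isOpen_of_forall_exists_mul {S : Set D.G}
    (h : ∀ g ∈ S, ∃ V : Set D.G, IsOpen V ∧ 1 ∈ V ∧ ∀ k ∈ V, g * k ∈ S) : IsOpen S := by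
  rw [isOpen_iff_mem_nhds]
  intro g hg
  obtain ⟨V, hV, h1, hVS⟩ := h g hg
  refine Filter.mem_of_superset
    ((hV.preimage (continuous_const_mul g⁻¹)).mem_nhds (x := g) (by simpa using h1)) ?_
  intro x hx
  simpa using hVS _ hx

/-- Treating `δ` and `δ⁻¹` together lets the induction pass through inverses. -/
theorem IsLeftOpen.preimage_mul_right {S : Set D.Gam} (hS : D.IsLeftOpen S) (δ : D.Gam) :
    D.IsLeftOpen {x | x * δ ∈ S} ∧ D.IsLeftOpen {x | x * δ⁻¹ ∈ S} := by
  induction δ using HNNExtension.induction_on generalizing S with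
  | of h =>
    have key : ∀ h, D.IsLeftOpen {x | x * D.of h ∈ S} := by
      intro h γ
      have := (hS γ).preimage (continuous_mul_const h)
      simpa [Set.preimage, mul_assoc] using this
    exact ⟨key h, by rw [← map_inv]; exact key h⁻¹⟩
  | t =>
    constructor
    · intro γ
      refine D.isOpen_of_forall_exists_mul fun g hg => ?_
      -- For `k = assoc a` one has `k t = t a`, so near `g` the condition becomes the trace of `S`
      -- on the coset of `γ g t`, near `a = 1`.
      refine ⟨_, D.isOpen_image_assoc (hS (γ * D.of g * D.t)), ⟨1, ?_, by simp⟩, ?_⟩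
      · simpa using hg
      · rintro _ ⟨a, ha, rfl⟩
        have ha' : γ * D.of g * D.t * D.of (a : D.G) ∈ S := ha
        rw [mul_assoc _ D.t, HNNExtension.t_mul_of] at ha'
        simpa [mul_assoc] using ha'
    · intro γ
      refine D.isOpen_of_forall_exists_mul fun g hg => ?_
      refine ⟨_, D.isOpen_image_assoc_symm (hS (γ * D.of g * D.t⁻¹)), ⟨1, ?_, by simp⟩, ?_⟩
      · simpa using hg
      · rintro _ ⟨b, hb, rfl⟩
        have hb' : γ * D.of g * D.t⁻¹ * D.of (b : D.G) ∈ S := hb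
        rw [mul_assoc _ D.t⁻¹, HNNExtension.inv_t_mul_of] at hb'
        simpa [mul_assoc] using hb'
  | mul x y hx hy =>
    constructor
    · simpa [mul_assoc] using (hx (hy hS).1).1
    · simpa [mul_assoc] using (hy (hx hS).2).2
  | inv x hx => exact ⟨(hx hS).2, by rw [inv_inv]; exact (hx hS).1⟩

/-- The traces of `γ U γ'` on `G` must be open: `U` itself is left-open in `Γ`, and right
translation preserves this. -/
theorem continuous_of : Continuous D.of := by
  refine continuous_generateFrom_iff.2 ?_
  rintro _ ⟨γ, γ', U, hU, rfl⟩
  have h : D.IsLeftOpen (D.of '' U) := by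
    intro δ
    by_cases hδ : ∃ h, δ = D.of h
    · obtain ⟨h, rfl⟩ := hδ
      convert hU.preimage (continuous_const_mul h) using 1
      ext g
      rw [Set.mem_ofPred_eq, ← map_mul, (HNNExtension.of_injective D.assoc).mem_set_image]
      rfl
    · convert isOpen_empty
      refine Set.eq_empty_of_forall_notMem fun g => ?_
      rintro ⟨u, -, hu⟩
      exact hδ ⟨u * g⁻¹, by rw [map_mul, hu, map_inv, mul_inv_cancel_right]⟩
  convert (h.preimage_mul_right D γ'⁻¹).1 γ⁻¹ using 1
  ext g
  simp only [Set.mem_preimage, Set.mem_image, Set.mem_ofPred_eq]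
  refine exists_congr fun u => and_congr_right fun _ => ?_
  rw [mul_assoc, mul_assoc, eq_inv_mul_iff_mul_eq, eq_mul_inv_iff_mul_eq, mul_assoc]

end

/-! ### The homomorphism `j` as a closed embedding -/

theorem jT_apply_vertex (γ δ : D.Gam) : D.jT γ (D.vertex δ) = D.vertex (γ * δ) := rfl

theorem continuous_jT : Continuous D.jT := by
  refine continuous_generateFrom_iff.2 ?_
  rintro _ ⟨v, w, rfl⟩
  obtain ⟨γ, rfl⟩ := QuotientGroup.mk_surjective v
  obtain ⟨δ, rfl⟩ := QuotientGroup.mk_surjective w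
  convert D.isOpen_image_of isOpen_univ δ γ⁻¹ using 1
  ext x
  change D.vertex (x * γ) = D.vertex δ ↔ _
  rw [eq_comm, vertex_eq_iff]
  simp only [Set.image_univ, Set.mem_range]
  refine exists_congr fun g => ?_
  rw [eq_comm, mul_inv_eq_iff_eq_mul]

theorem jN_of (g : D.G) : D.jN (D.of g) = D.inclG g := HNNExtension.lift_of _ _ _ g

theorem inclG_injective : Function.Injective D.inclG :=
  SemidirectProduct.inl_injective.comp Subtype.val_injective

theorem continuous_inclG : Continuous D.inclG :=
  (SemidirectProduct.continuous_inl _).comp continuous_subtype_val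

theorem mem_range_of_jT_fixes {γ : D.Gam} (h : D.jT γ (D.vertex 1) = D.vertex 1) :
    ∃ g, γ = D.of g := by
  rw [jT_apply_vertex, mul_one, eq_comm, vertex_eq_iff] at h
  simpa using h

theorem j_injective : Function.Injective D.j := by
  rw [injective_iff_map_eq_one]
  intro γ hγ
  have h1 : D.jT γ = 1 := congrArg Prod.fst hγ
  have h2 : D.jN γ = 1 := congrArg Prod.snd hγ
  obtain ⟨g, rfl⟩ := D.mem_range_of_jT_fixes (by rw [h1]; rfl)
  rw [jN_of] at h2
  rw [(injective_iff_map_eq_one D.inclG).1 D.inclG_injective g h2, map_one]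

theorem exists_isOpen_preimage_j_eq {U : Set D.G} (hU : IsOpen U) :
    ∃ W, IsOpen W ∧ D.j ⁻¹' W = D.of '' U := by
  obtain ⟨V, hV, rfl⟩ := isOpen_induced_iff.1 hU
  -- Fixing the base vertex cuts `Γ` down to `G`; the `N`-coordinate then detects `U`.
  refine ⟨{p | p.1 (D.vertex 1) = D.vertex 1} ∩ {p | p.2.left ∈ V},
    ((D.tree.isOpen_aut_apply_eq _ _).preimage continuous_fst).inter
      (hV.preimage ((SemidirectProduct.continuous_left _).comp continuous_snd)), ?_⟩
  ext γ
  constructor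
  · rintro ⟨h1, h2⟩
    obtain ⟨g, rfl⟩ := D.mem_range_of_jT_fixes h1
    refine ⟨g, ?_, rfl⟩
    change (D.jN (D.of g)).left ∈ V at h2
    rw [jN_of] at h2
    exact h2
  · rintro ⟨g, hg, rfl⟩
    refine ⟨?_, ?_⟩
    · change D.vertex (D.of g * 1) = D.vertex 1
      rw [mul_one, ← one_mul (D.of g), vertex_mul_of]
    · change (D.jN (D.of g)).left ∈ V
      rw [jN_of]
      exact hg

variable [IsTopologicalGroup N]

theorem continuous_jN : Continuous D.jN := by
  refine ⟨fun V hV => ?_⟩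
  -- The preimage of `V` is the union over `γ` of its traces on the cosets `γ G`.
  have hopen : ∀ γ, IsOpen ((fun g => γ * D.of g * 1) '' {g | D.jN γ * D.inclG g ∈ V}) := fun γ =>
    D.isOpen_image_of (hV.preimage ((continuous_const_mul _).comp D.continuous_inclG)) γ 1
  convert isOpen_iUnion hopen
  ext γ
  simp only [Set.mem_preimage, Set.mem_iUnion, Set.mem_image]
  constructor
  · intro h
    exact ⟨γ, 1, by simpa using h, by simp⟩
  · rintro ⟨δ, g, hg, rfl⟩
    rw [mul_one, map_mul, jN_of]
    exact hg

theorem continuous_j : Continuous D.j := D.continuous_jT.prodMk D.continuous_jN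

/-- Two-sided translation reduces a generating set `γ U γ'` to `U`. -/
theorem isInducing_j : IsInducing D.j := by
  refine ⟨le_antisymm D.continuous_j.le_induced (le_generateFrom ?_)⟩
  rintro _ ⟨γ, γ', U, hU, rfl⟩
  obtain ⟨W, hW, hWU⟩ := D.exists_isOpen_preimage_j_eq hU
  refine isOpen_induced_iff.2 ⟨(fun p => (D.j γ)⁻¹ * p * (D.j γ')⁻¹) ⁻¹' W,
    hW.preimage (by fun_prop), ?_⟩
  ext x
  have hx : x ∈ D.j ⁻¹' ((fun p => (D.j γ)⁻¹ * p * (D.j γ')⁻¹) ⁻¹' W) ↔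
      γ⁻¹ * x * γ'⁻¹ ∈ D.j ⁻¹' W := by
    simp [Set.mem_preimage]
  rw [hx, hWU]
  refine exists_congr fun u => and_congr_right fun _ => ?_
  rw [mul_assoc, eq_inv_mul_iff_mul_eq, eq_mul_inv_iff_mul_eq]

/-- This is the graph of `g ↦ jT (of g)` over the closed copy of `G` in `ℤ ⋉ N`, closed because `Aut
T` is Hausdorff. -/
theorem isClosed_range_j_comp_of : IsClosed (Set.range fun g => D.j (D.of g)) := by
  let F : Set ((D.tree ≃g D.tree) × D.Ntilde) := {p | p.2.left ∈ D.G} ∩ {p | p.2.right = 1}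
  have hl : Continuous fun p : (D.tree ≃g D.tree) × D.Ntilde => p.2.left :=
    (SemidirectProduct.continuous_left _).comp continuous_snd
  have hr : Continuous fun p : (D.tree ≃g D.tree) × D.Ntilde => p.2.right :=
    (SemidirectProduct.continuous_right _).comp continuous_snd
  have hF : IsClosed F := (D.isClosed_G.preimage hl).inter (isClosed_eq hr continuous_const)
  let r : F → D.G := fun p => ⟨p.1.2.left, p.2.1⟩
  have hrc : Continuous r := (hl.comp continuous_subtype_val).subtype_mk _
  have hE : IsClosed {p : F | p.1.1 = D.jT (D.of (r p))} :=
    isClosed_eq (continuous_fst.comp continuous_subtype_val)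
      (D.continuous_jT.comp (D.continuous_of.comp hrc))
  convert hF.isClosedEmbedding_subtypeVal.isClosedMap _ hE using 1
  ext p
  constructor
  · rintro ⟨g, rfl⟩
    have hg : (D.j (D.of g)).2 = D.inclG g := D.jN_of g
    refine ⟨⟨D.j (D.of g), ?_, ?_⟩, ?_, rfl⟩
    · change (D.j (D.of g)).2.left ∈ D.G
      rw [hg]; exact g.2
    · change (D.j (D.of g)).2.right = 1
      rw [hg]; rfl
    · change D.jT (D.of g) = D.jT (D.of ⟨(D.j (D.of g)).2.left, _⟩)
      congr 2
  · rintro ⟨⟨p, hp⟩, hp', rfl⟩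
    refine ⟨r ⟨p, hp⟩, Prod.ext (Eq.symm hp') ?_⟩
    change D.jN (D.of _) = p.2
    rw [jN_of]
    exact SemidirectProduct.ext rfl (Eq.symm hp.2)

theorem isClosed_range_j : IsClosed (Set.range D.j) := by
  refine isClosed_of_closure_subset fun p hp => ?_
  obtain ⟨γ, hγ⟩ := QuotientGroup.mk_surjective (p.1 (D.vertex 1))
  have hO : IsOpen {q : (D.tree ≃g D.tree) × D.Ntilde | q.1 (D.vertex 1) = D.vertex γ} :=
    (D.tree.isOpen_aut_apply_eq _ _).preimage continuous_fst
  have hC : IsClosed ((fun q => (D.j γ)⁻¹ * q) ⁻¹' Set.range fun g => D.j (D.of g)) :=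
    D.isClosed_range_j_comp_of.preimage (continuous_const_mul _)
  -- Elements of `Γ` sending the base vertex to `γ G` lie in `γ G`, so on this open set the image is
  -- contained in one closed coset.
  have hsub : {q : (D.tree ≃g D.tree) × D.Ntilde | q.1 (D.vertex 1) = D.vertex γ} ∩
      Set.range D.j ⊆ (fun q => (D.j γ)⁻¹ * q) ⁻¹' Set.range fun g => D.j (D.of g) := by
    rintro _ ⟨h, δ, rfl⟩
    have h' : D.vertex (δ * 1) = D.vertex γ := h
    obtain ⟨g, hg⟩ := D.vertex_eq_iff.1 h'.symm
    refine ⟨g, ?_⟩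
    change D.j (D.of g) = (D.j γ)⁻¹ * D.j δ
    rw [← map_inv, ← map_mul]
    rw [mul_one] at hg
    rw [hg, inv_mul_cancel_left]
  obtain ⟨g, hg⟩ := closure_minimal hsub hC (hO.inter_closure ⟨hγ.symm, hp⟩)
  refine ⟨γ * D.of g, ?_⟩
  rw [map_mul]
  exact (eq_inv_mul_iff_mul_eq.1 hg)

end BSDatum

theorem theorem1 {N H : Type*} [Group N] [TopologicalSpace N] [IsTopologicalGroup N]
    [LocallyCompactSpace N]
    (hN : ∃ K : Set N, IsCompact K ∧ Subgroup.closure K = ⊤)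
    [Group H] [TopologicalSpace H] [IsTopologicalGroup H]
    (D : BSDatum N H) :
    D.tree.IsTree ∧ (∀ v, (D.tree.neighborSet v).Finite) ∧ IsClosedEmbedding D.j :=
  ⟨D.tree_isTree, D.finite_tree_neighborSet,
    ⟨⟨D.isInducing_j, D.j_injective⟩, D.isClosed_range_j⟩⟩
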